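/- Let $X$ be a topological space, let $Y$ be a Fréchet space (a locally convex, complete metrizable topological vector space), and let $G$ be a dense subgroup of the additive group $Y^X$ of all functions $X\to Y$, where $Y^X$ carries the product topology (the topology of pointwise convergence) and $G$ the subspace topology. Then the following assertions are equivalent: 1. $G$ is $\omega$-full in $Y^X$: every function $f:Z\to Y$ defined on a countable subset $Z\subseteq X$ extends to a function $X\to Y$ that belongs to $G$; 2. $G$ is $G_\delta$-dense in $Y^X$: $G$ meets every nonempty $G_\delta$-subset of $Y^X$; 3. $G$ is countably base-compact: its topology has a base $\mathcal B$ such that $\bigcap_{S\in\mathcal S}\overline{S}\neq\emptyset$ for every countable centered subfamily $\mathcal S\subseteq\mathcal B$ (centered: every finite subfamily has nonempty intersection); 4. $G$ is strong Choquet: in the game in which, at each step $n=0,1,2,\dots$, player E chooses an open set $U_n$ and a point $x_n\in U_n$ (with $U_n\subseteq V_{n-1}$ if $n\ge 1$) and player N answers with an open set $V_n$ such that $x_n\in V_n\subseteq U_n$, and which N wins if and only if $\bigcap_n U_n\neq\emptyset$, player N has a winning strategy; 5. $G$ is Choquet: in the game in which, at each step $n=0,1,2,\dots$, player E chooses a nonempty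 open set $U_n$ (with $U_n\subseteq V_{n-1}$ if $n\ge 1$) and player N answers with a nonempty open set $V_n\subseteq U_n$, and which N wins if and only if $\bigcap_n U_n\neq\emptyset$, player N has a winning strategy. -/

import Mathlib

/-- A family `F ⊆ Y^X` is ω-full if every function defined on a countable subset of `X` with values
in `Y` extends to a member of `F`. -/
def IsOmegaFull {X Y : Type*} (F : Set (X → Y)) : Prop :=
  ∀ Z : Set X, Z.Countable → ∀ f : Z → Y, ∃ g ∈ F, ∀ z : Z, g z = f z

/-- A subset is `G_δ`-dense if it meets every nonempty `G_δ`-set of the ambient space. -/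
def IsGDeltaDense {T : Type*} [TopologicalSpace T] (A : Set T) : Prop :=
  ∀ H : Set T, IsGδ H → H.Nonempty → (A ∩ H).Nonempty

/-- A family of sets is centered if each of its finite subfamilies has nonempty intersection. -/
def IsCentered {T : Type*} (S : Set (Set T)) : Prop :=
  ∀ F : Set (Set T), F ⊆ S → F.Finite → (⋂₀ F).Nonempty

/-- Some base of the topology has the property that the closures of the members of any countable
centered subfamily have a common point. -/
def IsCountablyBaseCompact (T : Type*) [TopologicalSpace T] : Prop :=
  ∃ B : Set (Set T), TopologicalSpace.IsTopologicalBasis B ∧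
    ∀ S : Set (Set T), S ⊆ B → S.Countable → IsCentered S → (⋂ s ∈ S, closure s).Nonempty

/-- The list of the first `n + 1` terms `m 0, …, m n` of a sequence of moves. -/
def movesUpTo {M : Type*} (m : ℕ → M) (n : ℕ) : List M :=
  (List.range (n + 1)).map m

/-- The Choquet game: player E plays a nonempty open set `U 0`, player N answers with a nonempty
open set `V 0 ⊆ U 0`, then E plays a nonempty open set `U 1 ⊆ V 0`, and so on. Player N wins if
the intersection of the `U n` (which is that of the `V n`) is nonempty. The space is Choquet if N
has a winning strategy. A strategy `σ` gives the answer `V n` from the moves `U 0, …, U n` of E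
(the earlier answers of N are determined by these and by `σ`). The first condition says that the
answers are legal at each position reached by following `σ`, the second that N wins each infinite
run in which N follows `σ`. -/
def IsChoquet (T : Type*) [TopologicalSpace T] : Prop :=
  ∃ σ : List (Set T) → Set T,
    (∀ (U : ℕ → Set T) (n : ℕ),
      (∀ i ≤ n, IsOpen (U i) ∧ (U i).Nonempty) →
      (∀ i < n, U (i + 1) ⊆ σ (movesUpTo U i)) →
      IsOpen (σ (movesUpTo U n)) ∧ (σ (movesUpTo U n)).Nonempty ∧ σ (movesUpTo U n) ⊆ U n) ∧
    (∀ U : ℕ → Set T,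
      (∀ i, IsOpen (U i) ∧ (U i).Nonempty) →
      (∀ i, U (i + 1) ⊆ σ (movesUpTo U i)) →
      (⋂ i, U i).Nonempty)

/-- The strong Choquet game: the moves of player E are pairs `(U n, x n)` with `U n` open and
`x n ∈ U n`, and player N has to answer with an open set `V n` such that `x n ∈ V n ⊆ U n`; then
E chooses `U (n + 1) ⊆ V n`. Player N wins if the intersection of the `U n` is nonempty. The space
is strong Choquet if N has a winning strategy. Strategies are described as for the Choquet game. -/
def IsStrongChoquet (T : Type*) [TopologicalSpace T] : Prop :=
  ∃ σ : List (Set T × T) → Set T,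
    (∀ (m : ℕ → Set T × T) (n : ℕ),
      (∀ i ≤ n, IsOpen (m i).1 ∧ (m i).2 ∈ (m i).1) →
      (∀ i < n, (m (i + 1)).1 ⊆ σ (movesUpTo m i)) →
      IsOpen (σ (movesUpTo m n)) ∧ (m n).2 ∈ σ (movesUpTo m n) ∧
        σ (movesUpTo m n) ⊆ (m n).1) ∧
    (∀ m : ℕ → Set T × T,
      (∀ i, IsOpen (m i).1 ∧ (m i).2 ∈ (m i).1) →
      (∀ i, (m (i + 1)).1 ⊆ σ (movesUpTo m i)) →
      (⋂ i, (m i).1).Nonempty)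

/-! ### ω-fullness and `G_δ`-density -/

open Set Filter Topology TopologicalSpace

/-! A basic open set of the product restricts finitely many coordinates, so countably many of them
restrict countably many coordinates, where ω-fullness prescribes the values. This gives 1 → 2 and,
once `Y` itself is known to be countably base-compact (via `exists_open_cover_centered_finite`), 1 →
3. Conversely, points of `Y` are `G_δ`, which gives 2 → 1.

The group structure of `G` enters in 5 → 1. Extend `f` by zero and interleave two runs of one
winning strategy through translation by `f` (`IsChoquet.exists_common_orbit`), shrinking the moves
so that the outcomes satisfy `a = b + f` on the given countable set. Then `a - b ∈ G` extends `f`.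
-/

theorem IsOmegaFull.isGDeltaDense {X Y : Type*} [TopologicalSpace Y] {F : Set (X → Y)}
    (hF : IsOmegaFull F) : IsGDeltaDense F := by
  rintro H hH ⟨f, hf⟩
  obtain ⟨O, hO, rfl⟩ := hH.eq_iInter_nat
  rw [mem_iInter] at hf
  have key : ∀ n, ∃ (I : Finset X) (u : X → Set Y),
      (∀ a ∈ I, IsOpen (u a) ∧ f a ∈ u a) ∧ (I : Set X).pi u ⊆ O n := fun n =>
    isOpen_pi_iff.1 (hO n) f (hf n)
  choose I u hu hsub using key
  obtain ⟨g, hg, hgf⟩ := hF (⋃ n, (I n : Set X)) (countable_iUnion fun n => (I n).countable_toSet)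
    fun z => f z
  refine ⟨g, hg, mem_iInter.2 fun n => hsub n fun x hx => ?_⟩
  rw [show g x = f x from hgf ⟨x, mem_iUnion.2 ⟨n, hx⟩⟩]
  exact (hu n x hx).2

theorem IsGDeltaDense.isOmegaFull {X Y : Type*} [TopologicalSpace Y] [T1Space Y]
    [FirstCountableTopology Y] [Nonempty Y] {F : Set (X → Y)} (hF : IsGDeltaDense F) :
    IsOmegaFull F := by
  classical
  intro Z hZ f
  have : Countable Z := hZ.to_subtype
  have hG : IsGδ (⋂ z : Z, {h : X → Y | h z = f z}) := by
    refine IsGδ.iInter fun z => ?_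
    have hz : Continuous fun h : X → Y => h z := continuous_apply _
    exact (IsGδ.singleton (f z)).preimage hz
  obtain ⟨g, hg, hgf⟩ := hF _ hG ⟨fun x => if h : x ∈ Z then f ⟨x, h⟩ else Classical.arbitrary Y,
    mem_iInter.2 fun z => by simp⟩
  exact ⟨g, hg, fun z => mem_iInter.1 hgf z⟩

theorem IsCentered.mono {T : Type*} {S S' : Set (Set T)} (hS : IsCentered S') (h : S ⊆ S') :
    IsCentered S := fun F hF hfin => hS F (hF.trans h) hfin

/-! ### From base-compactness to the games -/

theorem IsCountablyBaseCompact.isStrongChoquet {T : Type*} [TopologicalSpace T] [RegularSpace T]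
    (hT : IsCountablyBaseCompact T) : IsStrongChoquet T := by
  obtain ⟨B, hB, hBS⟩ := hT
  have key : ∀ p : Set T × T, ∃ V : Set T, IsOpen p.1 → p.2 ∈ p.1 →
      V ∈ B ∧ p.2 ∈ V ∧ closure V ⊆ p.1 := by
    rintro ⟨U, x⟩
    by_cases h : IsOpen U ∧ x ∈ U
    · obtain ⟨V, hV, hVx, hVU⟩ := hB.exists_closure_subset (h.1.mem_nhds h.2)
      exact ⟨V, fun _ _ => ⟨hV, hVx, hVU⟩⟩
    · exact ⟨∅, fun h1 h2 => (h ⟨h1, h2⟩).elim⟩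
  choose v hv using key
  -- The answer depends on the last move only; the default is for the empty list, which never occurs
  -- in a run.
  let σ : List (Set T × T) → Set T := fun L => (L.getLast?.map v).getD ∅
  have hσ : ∀ (m : ℕ → Set T × T) n, σ (movesUpTo m n) = v (m n) := fun m n => by
    simp [σ, movesUpTo, List.range_succ]
  refine ⟨σ, fun m n hm _ => ?_, fun m hm hsub => ?_⟩
  · obtain ⟨h1, h2, h3⟩ := hv (m n) (hm n le_rfl).1 (hm n le_rfl).2
    rw [hσ]
    exact ⟨hB.isOpen h1, h2, subset_closure.trans h3⟩
  · simp only [hσ] at hsub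
    have hv' := fun n => hv (m n) (hm n).1 (hm n).2
    have hanti : Antitone fun n => v (m n) := antitone_nat_of_succ_le fun n =>
      (subset_closure.trans (hv' (n + 1)).2.2).trans (hsub n)
    obtain ⟨x, hx⟩ := hBS (range fun n => v (m n)) (range_subset_iff.2 fun n => (hv' n).1)
      (countable_range _) (by
        intro F hF hfin
        obtain ⟨N, hN⟩ : ∃ N, ∀ s ∈ F, v (m N) ⊆ s := by
          induction F, hfin using Set.Finite.induction_on with
          | empty => exact ⟨0, by simp⟩
          | @insert a s _ _ ih =>
            obtain ⟨N, hN⟩ := ih ((subset_insert _ _).trans hF)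
            obtain ⟨k, rfl⟩ := hF (mem_insert _ _)
            refine ⟨max N k, fun t ht => ?_⟩
            rcases ht with rfl | ht
            · exact hanti (le_max_right _ _)
            · exact (hanti (le_max_left _ _)).trans (hN t ht)
        exact ⟨(m N).2, fun s hs => hN s hs (hv' N).2.1⟩)
    refine ⟨x, mem_iInter.2 fun n => (hv' n).2.2 ?_⟩
    exact mem_iInter₂.1 hx _ (mem_range_self n)

theorem IsStrongChoquet.isChoquet {T : Type*} [TopologicalSpace T] [Nonempty T]
    (hT : IsStrongChoquet T) : IsChoquet T := by
  classical
  obtain ⟨σ, hσ, hwin⟩ := hT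
  let c : Set T → Set T × T := fun U => (U, Classical.epsilon fun x => x ∈ U)
  have hc : ∀ U : Set T, U.Nonempty → (c U).2 ∈ U := fun U hU => Classical.epsilon_spec hU
  have hmv : ∀ (U : ℕ → Set T) n, (movesUpTo U n).map c = movesUpTo (fun i => c (U i)) n :=
    fun U n => by simp [movesUpTo, Function.comp_def]
  refine ⟨fun L => σ (L.map c), fun U n hU hs => ?_, fun U hU hs => ?_⟩
  · simp only [hmv] at hs ⊢
    obtain ⟨h1, h2, h3⟩ := hσ (fun i => c (U i)) n
      (fun i hi => ⟨(hU i hi).1, hc _ (hU i hi).2⟩) hs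
    exact ⟨h1, ⟨_, h2⟩, h3⟩
  · simp only [hmv] at hs
    exact hwin (fun i => c (U i)) (fun i => ⟨(hU i).1, hc _ (hU i).2⟩) hs

/-! ### Base-compactness of `Y` and of `G` -/

/-- Every metric space has open covers of arbitrarily small mesh all of whose centered subfamilies
are finite. -/
theorem exists_open_cover_centered_finite (Y : Type*) [MetricSpace Y] {ε : ℝ} (hε : 0 < ε) :
    ∃ B : Set (Set Y), (∀ s ∈ B, IsOpen s) ∧ (∀ y, ∃ s ∈ B, y ∈ s) ∧
      (∀ s ∈ B, ∃ y, s ⊆ Metric.ball y ε) ∧ ∀ S ⊆ B, IsCentered S → S.Finite := by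
  classical
  obtain ⟨u, huo, huc, huf, hub⟩ := precise_refinement (fun y : Y => Metric.ball y ε)
    (fun _ => Metric.isOpen_ball) (iUnion_eq_univ_iff.2 fun y => ⟨y, Metric.mem_ball_self hε⟩)
  -- Local finiteness alone gives no uniform bound, since the common point varies with the finite
  -- subfamily. Cutting the cover into bands of a continuous majorant `φ` of its multiplicity makes
  -- a single member bound the multiplicity at every common point.
  obtain ⟨φ, hφ⟩ : ∃ φ : C(Y, ℝ), ∀ y, φ y ∈ Ici (({i | y ∈ u i}.ncard : ℕ) : ℝ) := by
    refine exists_continuous_forall_mem_convex_of_local_const (fun _ => convex_Ici _) fun y => ?_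
    obtain ⟨t, ht, hfin⟩ := huf y
    refine ⟨({i | (u i ∩ t).Nonempty}.ncard : ℕ), ?_⟩
    filter_upwards [ht] with z hz
    have h : {i | z ∈ u i} ⊆ {i | (u i ∩ t).Nonempty} := fun i hi => ⟨z, hi, hz⟩
    exact Nat.cast_le (α := ℝ).2 (ncard_le_ncard h hfin)
  let L : ℕ → Set Y := fun n => {y | (n : ℝ) - 1 < φ y ∧ φ y < n + 1}
  have hL : ∀ n, IsOpen (L n) := fun n =>
    (isOpen_lt continuous_const φ.continuous).inter (isOpen_lt φ.continuous continuous_const)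
  let w : Y × ℕ → Set Y := fun p => u p.1 ∩ L p.2
  refine ⟨range w, ?_, fun y => ?_, ?_, fun S hS hcent => ?_⟩
  · rintro _ ⟨p, rfl⟩
    exact (huo _).inter (hL _)
  · obtain ⟨i, hi⟩ := iUnion_eq_univ_iff.1 huc y
    have h0 : 0 ≤ φ y := (Nat.cast_nonneg _).trans (hφ y)
    refine ⟨_, ⟨(i, ⌊φ y⌋₊), rfl⟩, hi, ?_, Nat.lt_floor_add_one _⟩
    have := Nat.floor_le h0
    linarith
  · rintro _ ⟨p, rfl⟩
    exact ⟨p.1, inter_subset_left.trans (hub _)⟩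
  · by_contra hinf
    obtain ⟨s₀, hs₀⟩ := Set.Infinite.nonempty hinf
    obtain ⟨⟨i₀, n⟩, rfl⟩ := hS hs₀
    -- A point of `w (i₀, n)` has `φ < n + 1`, so it lies in at most `n + 1` of the `u i`, and only
    -- in bands `k < n + 2`.
    obtain ⟨F, hFS, hFc⟩ := Set.Infinite.exists_subset_card_eq hinf ((n + 1) * (n + 2) + 1)
    obtain ⟨y, hy⟩ := hcent (insert (w (i₀, n)) (F : Set (Set Y))) (insert_subset hs₀ hFS)
      (F.finite_toSet.insert _)
    have hyn : φ y < n + 1 := (hy _ (mem_insert _ _)).2.2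
    have hfin : {i | y ∈ u i}.Finite := huf.point_finite y
    have hcard : {i | y ∈ u i}.ncard ≤ n + 1 := by
      have : (({i | y ∈ u i}.ncard : ℕ) : ℝ) < n + 1 := (hφ y).trans_lt hyn
      exact_mod_cast this.le
    have hsub : F ⊆ (hfin.toFinset ×ˢ Finset.range (n + 2)).image w := by
      intro s hs
      obtain ⟨⟨i, k⟩, rfl⟩ := hS (hFS hs)
      have hyk := hy _ (mem_insert_of_mem _ hs)
      refine Finset.mem_image_of_mem _ (Finset.mem_product.2 ⟨?_, ?_⟩)
      · simpa using hyk.1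
      · have h1 : (k : ℝ) - 1 < φ y := hyk.2.1
        have : (k : ℝ) < (n + 2 : ℕ) := by push_cast; linarith
        exact Finset.mem_range.2 (by exact_mod_cast this)
    have h1 := (Finset.card_le_card hsub).trans Finset.card_image_le
    rw [Finset.card_product, Finset.card_range, hFc, ← ncard_eq_toFinset_card _ hfin] at h1
    have := Nat.mul_le_mul_right (n + 2) hcard
    omega

/-- An infinite centered family takes only finitely many members from each cover, hence has members
of arbitrarily small diameter. The filter it generates is then Cauchy, and its limit lies in all the
closures. -/
theorem isCountablyBaseCompact_of_isCompletelyMetrizableSpace (Y : Type*) [TopologicalSpace Y]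
    [IsCompletelyMetrizableSpace Y] : IsCountablyBaseCompact Y := by
  let _ := upgradeIsCompletelyMetrizable Y
  have hpos : ∀ n : ℕ, (0 : ℝ) < 1 / ((n : ℝ) + 1) := fun n => Nat.one_div_pos_of_nat
  choose B hBo hBc hBb hBf using fun n : ℕ => exists_open_cover_centered_finite Y (hpos n)
  refine ⟨⋃ n, B n, isTopologicalBasis_of_isOpen_of_nhds ?_ ?_, fun S hS _ hcent => ?_⟩
  · intro s hs
    obtain ⟨n, hn⟩ := mem_iUnion.1 hs
    exact hBo n s hn
  · intro y U hy hU
    obtain ⟨ε, hε, hεU⟩ := Metric.isOpen_iff.1 hU y hy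
    obtain ⟨n, hn⟩ := exists_nat_one_div_lt (half_pos hε)
    obtain ⟨s, hs, hys⟩ := hBc n y
    obtain ⟨z, hz⟩ := hBb n s hs
    refine ⟨s, mem_iUnion.2 ⟨n, hs⟩, hys, fun t ht => hεU ?_⟩
    have h1 := Metric.mem_ball.1 (hz hys)
    have h2 := Metric.mem_ball.1 (hz ht)
    have h3 := dist_triangle_right t y z
    exact Metric.mem_ball.2 (by linarith)
  by_cases hfin : S.Finite
  · obtain ⟨y, hy⟩ := hcent S Subset.rfl hfin
    exact ⟨y, mem_iInter₂.2 fun s hs => subset_closure (hy s hs)⟩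
  have hne : NeBot (generate S) := generate_neBot_iff.2 hcent
  have hcau : Cauchy (generate S) := by
    refine Metric.cauchy_iff.2 ⟨hne, fun ε hε => ?_⟩
    obtain ⟨n, hn⟩ := exists_nat_one_div_lt (half_pos hε)
    have hSfin : (S ∩ ⋃ k ∈ Iio n, B k).Finite := by
      rw [inter_iUnion₂]
      exact (finite_Iio n).biUnion fun k _ =>
        hBf k _ inter_subset_right (hcent.mono inter_subset_left)
    obtain ⟨s, hsS, hs⟩ := (Set.Infinite.sdiff hfin hSfin).nonempty
    obtain ⟨k, hk⟩ := mem_iUnion.1 (hS hsS)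
    have hnk : n ≤ k := not_lt.1 fun h => hs ⟨hsS, mem_iUnion₂.2 ⟨k, h, hk⟩⟩
    obtain ⟨z, hz⟩ := hBb k s hk
    refine ⟨s, GenerateSets.basic hsS, fun x hx y hy => ?_⟩
    have h1 := Metric.mem_ball.1 (hz hx)
    have h2 := Metric.mem_ball.1 (hz hy)
    have h3 := dist_triangle_right x y z
    have h4 := Nat.one_div_le_one_div (α := ℝ) hnk
    linarith
  obtain ⟨y, hy⟩ := CompleteSpace.complete hcau
  refine ⟨y, mem_iInter₂.2 fun s hs => mem_closure_iff_clusterPt.2 ?_⟩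
  exact hne.mono (le_inf hy (le_principal_iff.2 (GenerateSets.basic hs)))

theorem IsOmegaFull.isCountablyBaseCompact {X Y : Type*} [TopologicalSpace Y] [Nonempty Y]
    (hY : IsCountablyBaseCompact Y) {G : Set (X → Y)} (hG : Dense G) (hfull : IsOmegaFull G) :
    IsCountablyBaseCompact G := by
  classical
  obtain ⟨B, hB, hBS⟩ := hY
  refine ⟨_, (isTopologicalBasis_pi fun _ : X => hB).isInducing
    (IsInducing.subtypeVal (t := G)), fun S hS hcount hcent => ?_⟩
  have key : ∀ s ∈ S, ∃ (U : X → Set Y) (F : Finset X), (∀ x ∈ F, U x ∈ B) ∧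
      s = (Subtype.val ⁻¹' (F : Set X).pi U : Set G) := by
    intro s hs
    obtain ⟨_, ⟨U, F, hU, rfl⟩, rfl⟩ := hS hs
    exact ⟨U, F, hU, rfl⟩
  choose! U F hUB hs using key
  have hpt : ∀ x, ∃ y, ∀ s ∈ S, x ∈ F s → y ∈ closure (U s x) := by
    intro x
    obtain ⟨y, hy⟩ := hBS ((fun s => U s x) '' {s ∈ S | x ∈ F s})
      (by rintro _ ⟨s, ⟨h, hx⟩, rfl⟩; exact hUB s h x hx)
      ((hcount.mono (sep_subset _ _)).image _) (by
        intro T hT hfin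
        obtain ⟨S', hS', hfin', rfl⟩ := (Set.exists_subset_image_finite_and (p := (· = T))).1
          ⟨T, hT, hfin, rfl⟩
        obtain ⟨g, hg⟩ := hcent S' (hS'.trans (sep_subset _ _)) hfin'
        refine ⟨g.1 x, ?_⟩
        rintro _ ⟨s, h, rfl⟩
        have h1 := hg s h
        rw [hs s (hS' h).1] at h1
        exact h1 x (hS' h).2)
    exact ⟨y, fun s h hx => mem_iInter₂.1 hy _ (mem_image_of_mem _ ⟨h, hx⟩)⟩
  choose y hy using hpt
  obtain ⟨g, hg, hgy⟩ := hfull (⋃ s ∈ S, (F s : Set X))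
    (hcount.biUnion fun s _ => (F s).countable_toSet) fun x => y x
  refine ⟨⟨g, hg⟩, mem_iInter₂.2 fun s h => ?_⟩
  have hopen : IsOpen ((F s : Set X).pi (U s)) :=
    isOpen_set_pi (F s).finite_toSet fun x hx => hB.isOpen (hUB s h x hx)
  -- As `G` is dense, the trace of an open box on `G` has the same closure in the product as the
  -- box.
  rw [closure_subtype, hs s h, Subtype.image_preimage_coe, inter_comm]
  refine closure_minimal (hG.open_subset_closure_inter hopen) isClosed_closure ?_
  rw [closure_pi_set]
  intro x hx
  change g x ∈ closure (U s x)
  rw [show g x = y x from hgy ⟨x, mem_iUnion₂.2 ⟨s, h, hx⟩⟩]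
  exact hy x s h hx

/-! ### Interleaved runs of the Choquet game -/

/-- The largest open set of the ambient space with trace on `A` contained in `V`. -/
def openExtension {T : Type*} [TopologicalSpace T] {A : Set T} (V : Set A) : Set T :=
  ⋃₀ {W | IsOpen W ∧ Subtype.val ⁻¹' W ⊆ V}

section OpenExtension

variable {T : Type*} [TopologicalSpace T] {A : Set T}

theorem isOpen_openExtension (V : Set A) : IsOpen (openExtension V) :=
  isOpen_sUnion fun _ h => h.1

theorem preimage_openExtension_subset (V : Set A) : Subtype.val ⁻¹' openExtension V ⊆ V := by
  rintro x ⟨W, hW, hx⟩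
  exact hW.2 hx

theorem subset_preimage_openExtension {V : Set A} (hV : IsOpen V) :
    V ⊆ Subtype.val ⁻¹' openExtension V := by
  obtain ⟨W, hW, rfl⟩ := isOpen_induced_iff.1 hV
  exact fun x hx => ⟨W, ⟨hW, Subset.rfl⟩, hx⟩

end OpenExtension

theorem movesUpTo_succ {M : Type*} (m : ℕ → M) (n : ℕ) :
    movesUpTo m (n + 1) = movesUpTo m n ++ [m (n + 1)] := by
  simp [movesUpTo, List.range_succ]

/-- Two runs of the Choquet game on a dense subspace `A`, following the same strategy, whose
moves are interleaved through a homeomorphism `e` of the ambient space, and the moves in the first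
of which lie in the sets produced by the operations `r n`. -/
theorem IsChoquet.exists_common_orbit {T : Type*} [TopologicalSpace T] [Nonempty T] {A : Set T}
    (hA : Dense A) (hc : IsChoquet A) (e : T ≃ₜ T) (r : ℕ → Set T → Set T)
    (hr : ∀ n U, IsOpen U → U.Nonempty → IsOpen (r n U) ∧ (r n U).Nonempty)
    (hrs : ∀ n U, r n U ⊆ U) :
    ∃ a ∈ A, ∃ b ∈ A, ∀ n, ∃ U, a ∈ r n U ∧ e b ∈ r n U := by
  obtain ⟨σ, hσ, hwin⟩ := hc
  let tr : Set T → Set A := fun O => Subtype.val ⁻¹' O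
  -- Each answer, moved through `e`, yields the next move in the other run. An answer lies in the
  -- preceding move only as a trace on `A`; intersecting with `p.1` restores the inclusion in the
  -- ambient space.
  let O' : Set T × List (Set A) → Set T := fun p => e ⁻¹' (openExtension (σ p.2) ∩ p.1)
  let back : Set T × List (Set A) → Set T :=
    fun p => e.symm ⁻¹' (openExtension (σ p.2) ∩ p.1)
  let q₀ : Set T × List (Set A) := (r 0 univ, [tr (r 0 univ)])
  let st : ℕ → (Set T × List (Set A)) × (Set T × List (Set A)) := fun n =>
    Nat.rec (q₀, (O' q₀, [tr (O' q₀)]))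
      (fun n p =>
        let O := r (n + 1) (back p.2)
        let q := (O, p.1.2 ++ [tr O])
        (q, (O' q, p.2.2 ++ [tr (O' q)]))) n
  let U : ℕ → Set A := fun n => tr (st n).1.1
  let U' : ℕ → Set A := fun n => tr (st n).2.1
  have hL : ∀ n, (st n).1.2 = movesUpTo U n := by
    intro n
    induction n with
    | zero => rfl
    | succ n ih => rw [movesUpTo_succ, ← ih]
  have hL' : ∀ n, (st n).2.2 = movesUpTo U' n := by
    intro n
    induction n with
    | zero => rfl
    | succ n ih => rw [movesUpTo_succ, ← ih]
  have hO' : ∀ n, (st n).2.1 = e ⁻¹' (openExtension (σ (movesUpTo U n)) ∩ (st n).1.1) := by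
    intro n
    rw [← hL]
    cases n <;> rfl
  have hO : ∀ n, (st (n + 1)).1.1 =
      r (n + 1) (e.symm ⁻¹' (openExtension (σ (movesUpTo U' n)) ∩ (st n).2.1)) := by
    intro n
    rw [← hL']
  have hst₀ : (st 0).1.1 = r 0 univ := rfl
  clear_value st
  have hsub : ∀ n, U (n + 1) ⊆ σ (movesUpTo U n) := by
    intro n x hx
    have h1 : x.1 ∈ (st (n + 1)).1.1 := hx
    rw [hO] at h1
    have h2 := (hrs _ _ h1).2
    rw [hO'] at h2
    have h3 := h2.1
    rw [e.apply_symm_apply] at h3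
    exact preimage_openExtension_subset _ h3
  have hsub' : ∀ n, U' (n + 1) ⊆ σ (movesUpTo U' n) := by
    intro n x hx
    have h1 : x.1 ∈ (st (n + 1)).2.1 := hx
    rw [hO'] at h1
    have h2 := h1.2
    rw [hO] at h2
    have h3 := (hrs _ _ h2).1
    rw [e.symm_apply_apply] at h3
    exact preimage_openExtension_subset _ h3
  have htr : ∀ O : Set T, IsOpen O → O.Nonempty → IsOpen (tr O) ∧ (tr O).Nonempty := by
    intro O h1 h2
    obtain ⟨x, hxO, hx⟩ := hA.inter_open_nonempty O h1 h2
    exact ⟨h1.preimage continuous_subtype_val, ⟨x, hx⟩, hxO⟩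
  have hans : ∀ (W : ℕ → Set A) (O : Set T) (n : ℕ), W n = tr O → IsOpen O →
      (∀ i ≤ n, IsOpen (W i) ∧ (W i).Nonempty) → (∀ i, W (i + 1) ⊆ σ (movesUpTo W i)) →
      IsOpen (openExtension (σ (movesUpTo W n)) ∩ O) ∧
        (openExtension (σ (movesUpTo W n)) ∩ O).Nonempty := by
    intro W O n hW hOo h1 h2
    obtain ⟨h3, ⟨x, hx⟩, h5⟩ := hσ W n h1 fun i _ => h2 i
    refine ⟨(isOpen_openExtension _).inter hOo, x, subset_preimage_openExtension h3 hx, ?_⟩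
    have := h5 hx
    rwa [hW] at this
  have hlegal : ∀ n, (IsOpen (st n).1.1 ∧ (st n).1.1.Nonempty) ∧
      (IsOpen (st n).2.1 ∧ (st n).2.1.Nonempty) := by
    intro n
    induction n using Nat.strong_induction_on with
    | _ n ih =>
      have h1 : IsOpen (st n).1.1 ∧ (st n).1.1.Nonempty := by
        cases n with
        | zero => rw [hst₀]; exact hr 0 univ isOpen_univ univ_nonempty
        | succ n =>
          rw [hO]
          obtain ⟨h1, h2⟩ := hans U' (st n).2.1 n rfl (ih n n.lt_succ_self).2.1
            (fun i hi => htr _ (ih i (by omega)).2.1 (ih i (by omega)).2.2) hsub'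
          exact hr _ _ (h1.preimage e.symm.continuous) (h2.preimage e.symm.surjective)
      refine ⟨h1, ?_⟩
      rw [hO']
      obtain ⟨h2, h3⟩ := hans U (st n).1.1 n rfl h1.1 (fun i hi => by
        rcases hi.eq_or_lt with rfl | hi
        · exact htr _ h1.1 h1.2
        · exact htr _ (ih i hi).1.1 (ih i hi).1.2) hsub
      exact ⟨h2.preimage e.continuous, h3.preimage e.surjective⟩
  obtain ⟨a, ha⟩ := hwin U (fun i => htr _ (hlegal i).1.1 (hlegal i).1.2) hsub
  obtain ⟨b, hb⟩ := hwin U' (fun i => htr _ (hlegal i).2.1 (hlegal i).2.2) hsub'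
  rw [mem_iInter] at ha hb
  refine ⟨a, a.2, b, b.2, fun n => ?_⟩
  have h1 : a.1 ∈ (st n).1.1 := ha n
  have h2 : b.1 ∈ (st n).2.1 := hb n
  rw [hO'] at h2
  have h3 : e b.1 ∈ (st n).1.1 := h2.2
  cases n with
  | zero => rw [hst₀] at h1 h3; exact ⟨univ, h1, h3⟩
  | succ n =>
    rw [hO] at h1 h3
    exact ⟨_, h1, h3⟩

theorem IsChoquet.isOmegaFull {X Y : Type*} [AddCommGroup Y] [TopologicalSpace Y]
    [IsTopologicalAddGroup Y] [MetrizableSpace Y] {G : AddSubgroup (X → Y)}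
    (hG : Dense (G : Set (X → Y))) (hc : IsChoquet G) : IsOmegaFull (G : Set (X → Y)) := by
  classical
  let _ := metrizableSpaceMetric Y
  intro Z hZ f
  let f' : X → Y := fun x => if h : x ∈ Z then f ⟨x, h⟩ else 0
  rcases Z.eq_empty_or_nonempty with rfl | hne
  · exact ⟨0, G.zero_mem, fun z => z.2.elim⟩
  obtain ⟨z, rfl⟩ := hZ.exists_eq_range hne
  -- The center `p U` depends on `U` alone, so `a` and `b + f'` are both close to the same point at
  -- `z 0, …, z n`.
  let p : Set (X → Y) → X → Y := fun U => Classical.epsilon fun h => h ∈ U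
  let D : ℕ → Set (X → Y) → Set (X → Y) := fun n U =>
    ⋂ i ∈ Iic n, {h | dist (h (z i)) (p U (z i)) < 1 / ((n : ℝ) + 1)}
  obtain ⟨a, ha, b, hb, hab⟩ := IsChoquet.exists_common_orbit hG hc (Homeomorph.addRight f')
    (fun n U => U ∩ D n U)
    (fun n U hU hUn => ⟨hU.inter ((finite_Iic n).isOpen_biInter fun i _ =>
        isOpen_lt ((continuous_apply (z i)).dist continuous_const) continuous_const),
      p U, Classical.epsilon_spec hUn, mem_iInter₂.2 fun i _ => by
        simpa using Nat.cast_add_one_pos (α := ℝ) n⟩)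
    (fun n U => inter_subset_left)
  refine ⟨a - b, G.sub_mem ha hb, ?_⟩
  rintro ⟨_, k, rfl⟩
  have h0 : dist (a (z k)) (b (z k) + f' (z k)) = 0 := by
    refine le_antisymm (le_of_forall_pos_le_add fun ε hε => ?_) dist_nonneg
    obtain ⟨n, hn⟩ := exists_nat_one_div_lt (half_pos hε)
    -- Stage at least `k` controls the coordinate `z k`; stage at least `n` gives the precision.
    obtain ⟨U, h1, h2⟩ := hab (max n k)
    have h3 : dist (a (z k)) (p U (z k)) < 1 / ((max n k : ℕ) + 1 : ℝ) :=
      mem_iInter₂.1 h1.2 k (le_max_right n k)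
    have h4 : dist (b (z k) + f' (z k)) (p U (z k)) < 1 / ((max n k : ℕ) + 1 : ℝ) :=
      mem_iInter₂.1 h2.2 k (le_max_right n k)
    have h5 := dist_triangle_right (a (z k)) (b (z k) + f' (z k)) (p U (z k))
    have h6 := Nat.one_div_le_one_div (α := ℝ) (le_max_left n k)
    linarith
  rw [dist_eq_zero] at h0
  simp [h0, f']

theorem mainTheorem4 {X Y : Type*} [TopologicalSpace X]
    [AddCommGroup Y] [Module ℝ Y] [TopologicalSpace Y] [IsTopologicalAddGroup Y]
    [ContinuousSMul ℝ Y] [LocallyConvexSpace ℝ Y]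
    [TopologicalSpace.IsCompletelyMetrizableSpace Y]
    (G : AddSubgroup (X → Y)) (hG : Dense (G : Set (X → Y))) :
    [ IsOmegaFull (G : Set (X → Y)),
      IsGDeltaDense (G : Set (X → Y)),
      IsCountablyBaseCompact G,
      IsStrongChoquet G,
      IsChoquet G ].TFAE := by
  tfae_have 1 → 2 := IsOmegaFull.isGDeltaDense
  tfae_have 2 → 1 := IsGDeltaDense.isOmegaFull
  tfae_have 1 → 3 := IsOmegaFull.isCountablyBaseCompact
    (isCountablyBaseCompact_of_isCompletelyMetrizableSpace Y) hG
  tfae_have 3 → 4 := IsCountablyBaseCompact.isStrongChoquet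
  tfae_have 4 → 5 := IsStrongChoquet.isChoquet
  tfae_have 5 → 1 := IsChoquet.isOmegaFull hG
  tfae_finish
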